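/- All locally compact groups are Hausdorff. Let $G$ be a locally compact abelian group. A cut-and-project scheme $(G,H,\mathcal L)$ consists of $G$, a locally compact abelian group $H$ and a discrete cocompact subgroup $\mathcal L\subseteq G\times H$ such that the projection $\pi^G\colon\mathcal L\to G$ is injective and the projection of $\mathcal L$ to $H$ is dense in $H$. For $W\subseteq H$ put $\Lambda_W=\pi^G(\mathcal L\cap(G\times W))$. Call $W\subseteq H$ a regular window if $W$ is Borel measurable, $\overline W$ is compact, $W^\circ\neq\varnothing$, and $\partial W=\overline W\setminus W^\circ$ has Haar measure zero. A set $\Gamma\subseteq G$ is called - a regular model set if there are a cut-and-project scheme $(G,H,\mathcal L)$ and a regular window $W\subseteq H$ with $\Gamma=\Lambda_W$; - an inter regular model set if there are a cut-and-project scheme $(G,H,\mathcal L)$ and a regular window $W\subseteq H$ with $\Lambda_{W^\circ}\subseteq\Gamma\subseteq\Lambda_{\overline W}$; - an almost regular model set if there are a cut-and-project scheme $(G,H,\mathcal L)$ and sets $U\subseteq W\subseteq H$ with $U$ non-empty and open, $W$ compact, $W\setminus U$ of Haar measure zero, and $\Lambda_U\subseteq\Gamma\subseteq\Lambda_W$.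 A point set is a set $\Gamma\subseteq G$ such that $\Gamma\cap K$ is finite for every compact $K\subseteq G$. It has finite local complexity if for every compact $K\subseteq G$ the collection $\{(-x+\Gamma)\cap K : x\in\Gamma\}$ is finite. It is repetitive if for every compact $K\subseteq G$ the set $T_K=\{t\in G : (-t+\Gamma)\cap K=\Gamma\cap K\}$ is relatively dense, i.e. $T_K+C=G$ for some compact $C\subseteq G$. Let $\Gamma\subseteq G$ be a repetitive point set of finite local complexity. Then the following are equivalent: (i) $\Gamma$ is a regular model set; (ii) $\Gamma$ is an inter regular model set; (iii) $\Gamma$ is an almost regular model set. -/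

import Mathlib

open scoped Pointwise

universe u v

/-- `(G, H, L)` is a cut-and-project scheme (for locally compact Hausdorff abelian groups `G`, `H`):
`L` is a discrete cocompact subgroup of `G × H` that projects injectively to `G` and densely to
`H`. -/
structure IsCutAndProjectScheme {G : Type u} {H : Type v} [AddCommGroup G] [TopologicalSpace G]
    [AddCommGroup H] [TopologicalSpace H] (L : AddSubgroup (G × H)) : Prop where
  discrete : DiscreteTopology L
  cocompact : CompactSpace ((G × H) ⧸ L)
  injOn_fst : Set.InjOn Prod.fst (L : Set (G × H))
  dense_snd : Dense (Prod.snd '' (L : Set (G × H)))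

/-- The projection set `Λ_W = π^G(L ∩ (G × W))`. -/
def projectionSet {G : Type u} {H : Type v} [AddCommGroup G] [AddCommGroup H]
    (L : AddSubgroup (G × H)) (W : Set H) : Set G :=
  Prod.fst '' ((L : Set (G × H)) ∩ Set.univ ×ˢ W)

/-- Windows of weak model sets: relatively compact and Borel measurable. -/
def IsWeakModelWindow {H : Type v} [TopologicalSpace H] [MeasurableSpace H] (W : Set H) : Prop :=
  IsCompact (closure W) ∧ MeasurableSet W

/-- Windows of model sets: additionally with an interior point. -/
def IsModelWindow {H : Type v} [TopologicalSpace H] [MeasurableSpace H] (W : Set H) : Prop :=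
  IsWeakModelWindow W ∧ (interior W).Nonempty

/-- Windows of regular model sets: additionally the topological boundary has Haar measure zero. -/
def IsRegularModelWindow {H : Type v} [AddCommGroup H] [TopologicalSpace H]
    [IsTopologicalAddGroup H] [LocallyCompactSpace H] [MeasurableSpace H] [BorelSpace H]
    (W : Set H) : Prop :=
  IsModelWindow W ∧ MeasureTheory.Measure.addHaar (frontier W) = 0

/-- `Γ = Λ_W` for a regular window `W` in some cut-and-project scheme `(G, H, L)`. Taking `H` in the
universe of `G` is no restriction, since `H` is Hausdorff and has a dense subset which is the image
of a subset of `G`. -/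
def IsRegularModelSet {G : Type u} [AddCommGroup G] [TopologicalSpace G] (Γ : Set G) : Prop :=
  ∃ (H : Type u) (_ : AddCommGroup H) (_ : TopologicalSpace H) (_ : IsTopologicalAddGroup H)
    (_ : LocallyCompactSpace H) (_ : T2Space H) (_ : MeasurableSpace H) (_ : BorelSpace H)
    (L : AddSubgroup (G × H)) (W : Set H),
    IsCutAndProjectScheme L ∧ IsRegularModelWindow W ∧ Γ = projectionSet L W

/-- `Λ_{int W} ⊆ Γ ⊆ Λ_{cl W}` for a regular window `W` in some cut-and-project scheme. -/
def IsInterRegularModelSet {G : Type u} [AddCommGroup G] [TopologicalSpace G] (Γ : Set G) : Prop :=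
  ∃ (H : Type u) (_ : AddCommGroup H) (_ : TopologicalSpace H) (_ : IsTopologicalAddGroup H)
    (_ : LocallyCompactSpace H) (_ : T2Space H) (_ : MeasurableSpace H) (_ : BorelSpace H)
    (L : AddSubgroup (G × H)) (W : Set H),
    IsCutAndProjectScheme L ∧ IsRegularModelWindow W ∧
      projectionSet L (interior W) ⊆ Γ ∧ Γ ⊆ projectionSet L (closure W)

/-- `Λ_U ⊆ Γ ⊆ Λ_W` in some cut-and-project scheme, where `U ⊆ W`, `U` is non-empty and open, `W` is
compact, and `W \ U` has Haar measure zero. -/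
def IsAlmostRegularModelSet {G : Type u} [AddCommGroup G] [TopologicalSpace G] (Γ : Set G) : Prop :=
  ∃ (H : Type u) (_ : AddCommGroup H) (_ : TopologicalSpace H) (_ : IsTopologicalAddGroup H)
    (_ : LocallyCompactSpace H) (_ : T2Space H) (_ : MeasurableSpace H) (_ : BorelSpace H)
    (L : AddSubgroup (G × H)) (U W : Set H),
    IsCutAndProjectScheme L ∧ U ⊆ W ∧ U.Nonempty ∧ IsOpen U ∧ IsCompact W ∧
      MeasureTheory.Measure.addHaar (W \ U) = 0 ∧
      projectionSet L U ⊆ Γ ∧ Γ ⊆ projectionSet L W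

/-- A point set: a locally finite subset. -/
def IsPointSet {G : Type u} [TopologicalSpace G] (Γ : Set G) : Prop :=
  ∀ K : Set G, IsCompact K → (Γ ∩ K).Finite

/-- Finite local complexity: for each compact `K` there are only finitely many `K`-clusters
`(-x + Γ) ∩ K`, where `x ∈ Γ`. -/
def HasFiniteLocalComplexity {G : Type u} [AddCommGroup G] [TopologicalSpace G] (Γ : Set G) :
    Prop :=
  ∀ K : Set G, IsCompact K → ((fun x : G => (-x +ᵥ Γ) ∩ K) '' Γ).Finite

/-- `T` is relatively dense: `T + C = G` for some compact `C`. -/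
def IsRelativelyDense {G : Type u} [AddCommGroup G] [TopologicalSpace G] (T : Set G) : Prop :=
  ∃ C : Set G, IsCompact C ∧ T + C = Set.univ

/-- Repetitivity: for each compact `K`, the set of all `t` with `(-t + Γ) ∩ K = Γ ∩ K` is relatively
dense. -/
def IsRepetitive {G : Type u} [AddCommGroup G] [TopologicalSpace G] (Γ : Set G) : Prop :=
  ∀ K : Set G, IsCompact K → IsRelativelyDense {t : G | (-t +ᵥ Γ) ∩ K = Γ ∩ K}

/-! Only the passage from almost regular to regular has content. The natural window is `U` together
with the star image of `Γ`. It can fail twice: the star map need not be injective, so the window may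
select points outside `Γ`, and the star image of an uncountable `Γ` need not be Borel. Both defects
vanish after enlarging `H` by a compact group `B` with an injective homomorphism `ψ : G → B` whose
image is a countable union of discrete sets: the new star map `g ↦ (g*, ψ g)` is injective, and the
star image of `Γ` is a countable union of discrete, hence Borel, sets. The projection of the new
internal space to `H` is continuous, onto and proper, so it pulls `W \ U` back to a null set
(`addHaar_preimage_eq_zero`).

For `B` a power of the circle suffices. The group `G` embeds into a direct sum of copies of a
countable divisible subgroup of the circle, and elements with a fixed support size and values in a
fixed finite set form a discrete subset (`exists_hom_circle_pi_sigma_discrete`). -/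

/-! ### Embedding abelian groups into powers of the circle -/

/-- The homomorphism `(p, q) ↦ p + q √2 mod 1`. -/
noncomputable def ratSqrtTwoToCircle : ℚ × ℚ →+ UnitAddCircle :=
  (QuotientAddGroup.mk' (AddSubgroup.zmultiples (1 : ℝ))).comp
    ((Rat.castHom ℝ).toAddMonoidHom.coprod
      ((AddMonoidHom.mulRight (√2)).comp (Rat.castHom ℝ).toAddMonoidHom))

theorem ratSqrtTwoToCircle_apply (x : ℚ × ℚ) :
    ratSqrtTwoToCircle x = (((x.1 : ℝ) + x.2 * √2 : ℝ) : UnitAddCircle) := rfl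

theorem ratSqrtTwoToCircle_eq_zero_iff (p q : ℚ) :
    ratSqrtTwoToCircle (p, q) = 0 ↔ q = 0 ∧ ∃ n : ℤ, p = n := by
  rw [ratSqrtTwoToCircle_apply, AddCircle.coe_eq_zero_iff]
  constructor
  · rintro ⟨n, hn⟩
    simp only [zsmul_eq_mul, mul_one] at hn
    have hq : q = 0 := by
      by_contra hq
      refine irrational_sqrt_two ⟨(n - p) / q, ?_⟩
      have : (q : ℝ) ≠ 0 := by exact_mod_cast hq
      push_cast
      field_simp
      linarith
    refine ⟨hq, n, ?_⟩
    subst hq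
    simp only [Rat.cast_zero, zero_mul, add_zero] at hn
    exact_mod_cast hn.symm
  · rintro ⟨rfl, n, rfl⟩
    exact ⟨n, by simp⟩

/-- The circle has elements of every order in the countable divisible subgroup `ℚ + ℚ √2`. -/
theorem exists_zsmul_ratSqrtTwoToCircle_eq_zero_iff {D : Type*} [AddCommGroup D] (x : D) :
    ∃ a : ratSqrtTwoToCircle.range, ∀ n : ℤ, n • a = 0 ↔ n • x = 0 := by
  -- Order `0` means infinite order, which the class of `√2` has; order `m > 0` is realised by `1 /
  -- m`.
  by_cases h : addOrderOf x = 0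
  · refine ⟨⟨_, (0, 1), rfl⟩, fun n => ?_⟩
    rw [Subtype.ext_iff, AddSubgroup.coe_zsmul, ← map_zsmul, AddSubgroup.coe_zero,
      Prod.smul_mk, ratSqrtTwoToCircle_eq_zero_iff,
      ← addOrderOf_dvd_iff_zsmul_eq_zero (x := x), h]
    simpa using fun _ => ⟨0, Int.cast_zero.symm⟩
  · refine ⟨⟨_, ((addOrderOf x : ℚ)⁻¹, 0), rfl⟩, fun n => ?_⟩
    rw [Subtype.ext_iff, AddSubgroup.coe_zsmul, ← map_zsmul, AddSubgroup.coe_zero,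
      Prod.smul_mk, ratSqrtTwoToCircle_eq_zero_iff,
      ← addOrderOf_dvd_iff_zsmul_eq_zero (x := x)]
    have h' : (addOrderOf x : ℚ) ≠ 0 := by exact_mod_cast h
    simp only [smul_zero, true_and, zsmul_eq_mul]
    refine exists_congr fun m => ?_
    rw [← div_eq_mul_inv, div_eq_iff h', mul_comm]
    norm_cast

theorem Finsupp.surjective_zsmul (ι A : Type*) [AddCommGroup A] [DivisibleBy A ℤ] {n : ℤ}
    (hn : n ≠ 0) : Function.Surjective fun f : ι →₀ A => n • f := fun f => by
  obtain ⟨g, rfl⟩ := Finsupp.mapRange_surjective (α := ι) (fun a : A => n • a) (smul_zero n)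
    (DivisibleBy.surjective_smul A _ hn) f
  exact ⟨g, by ext; simp⟩

/-- A set is independent if the cyclic subgroups generated by its elements form a direct sum. -/
def CyclicIndependent {D : Type*} [AddCommGroup D] (s : Set D) : Prop :=
  ∀ f : D →₀ ℤ, (f.support : Set D) ⊆ s → Finsupp.linearCombination ℤ id f = 0 →
    ∀ x, f x • x = 0

/-- Zorn applies because a relation involves finitely many elements, which all lie in one member of
a chain. -/
theorem exists_maximal_cyclicIndependent (D : Type*) [AddCommGroup D] :
    ∃ s : Set D, Maximal CyclicIndependent s := by
  obtain ⟨s, -, hs⟩ := zorn_subset_nonempty {s : Set D | CyclicIndependent s} (by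
    intro c hc hchain hne
    refine ⟨⋃₀ c, ?_, fun s hs => Set.subset_sUnion_of_mem hs⟩
    intro f hf h0
    obtain ⟨t, htc, ht⟩ := DirectedOn.exists_mem_subset_of_finset_subset_biUnion hne
      (f := id) hchain.directedOn (by simpa [Set.sUnion_eq_biUnion] using hf)
    exact hc htc f ht h0) ∅ (by
    intro f hf h0 x
    have : f = 0 := by simpa using hf
    simp [this])
  exact ⟨s, hs⟩

/-- The cyclic subgroups generated by a maximal independent set span an essential subgroup. -/
theorem exists_zsmul_mem_span_of_maximal_cyclicIndependent {D : Type*} [AddCommGroup D]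
    {s : Set D} (hs : Maximal CyclicIndependent s) {d : D} (hd : d ≠ 0) :
    ∃ n : ℤ, n • d ≠ 0 ∧ n • d ∈ Submodule.span ℤ s := by
  classical
  by_cases hds : d ∈ s
  · exact ⟨1, by simpa, by simpa using Submodule.subset_span hds⟩
  have hnot : ¬ CyclicIndependent (insert d s) := fun h =>
    hds (hs.le_of_ge h (Set.subset_insert d s) (Set.mem_insert d s))
  simp only [CyclicIndependent, not_forall] at hnot
  obtain ⟨f, hf, h0, x, hx⟩ := hnot
  have hsupp : ((f.erase d).support : Set D) ⊆ s := by
    intro y hy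
    simp only [Finsupp.support_erase, Finset.coe_erase, Set.mem_sdiff, Finset.mem_coe,
      Set.mem_singleton_iff] at hy
    exact (hf hy.1).resolve_left hy.2
  have hsplit : f d • d + Finsupp.linearCombination ℤ id (f.erase d) = 0 := by
    rw [← h0]
    conv_rhs => rw [← Finsupp.single_add_erase d f]
    simp
  -- If `f d • d` vanished, the rest of the relation would live in `s` and be trivial, making `f`
  -- trivial too.
  refine ⟨f d, fun hfd => ?_, ?_⟩
  · rw [hfd, zero_add] at hsplit
    have := hs.prop _ hsupp hsplit
    rcases eq_or_ne x d with rfl | hxd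
    · exact hx hfd
    · exact hx (by simpa [Finsupp.erase_ne hxd] using this x)
  · rw [eq_neg_of_add_eq_zero_left hsplit]
    refine Submodule.neg_mem _ ?_
    exact Submodule.sum_mem _ fun y hy =>
      Submodule.smul_mem _ _ (Submodule.subset_span (hsupp hy))

/-- Every abelian group embeds into a direct sum of copies of a countable subgroup of the
circle. -/
theorem exists_injective_finsupp_ratSqrtTwoToCircle (D : Type u) [AddCommGroup D] :
    ∃ f : D →+ (D →₀ ratSqrtTwoToCircle.range), Function.Injective f := by
  classical
  obtain ⟨s, hs⟩ := exists_maximal_cyclicIndependent D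
  choose a ha using fun x : D => exists_zsmul_ratSqrtTwoToCircle_eq_zero_iff x
  let _ : DivisibleBy ratSqrtTwoToCircle.range ℤ :=
    ratSqrtTwoToCircle.rangeRestrict_surjective.divisibleBy _ (fun x n => map_zsmul _ _ _)
  let _ : DivisibleBy (D →₀ ratSqrtTwoToCircle.range) ℤ :=
    divisibleByOfSMulRightSurj _ _ (Finsupp.surjective_zsmul D _)
  let T : (s →₀ ℤ) →ₗ[ℤ] D := Finsupp.linearCombination ℤ Subtype.val
  let F : (s →₀ ℤ) →ₗ[ℤ] (D →₀ ratSqrtTwoToCircle.range) :=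
    Finsupp.linearCombination ℤ fun x => Finsupp.single x.1 (a x)
  -- By independence on both sides, a relation holds exactly when each of its terms vanishes, and `a
  -- x` has the order of `x`.
  have hFT : T.ker = F.ker := by
    have hT : ∀ v, v ∈ T.ker ↔ ∀ x, v x • (x : D) = 0 := fun v => by
      refine ⟨fun hv x => ?_, fun hv => Finset.sum_eq_zero fun x _ => hv x⟩
      have := hs.prop (v.mapDomain Subtype.val) (fun y hy => by
        obtain ⟨z, -, rfl⟩ := Finset.mem_image.1 (Finsupp.mapDomain_support hy)
        exact z.2) (by rw [Finsupp.linearCombination_mapDomain]; exact hv) x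
      rwa [Finsupp.mapDomain_apply Subtype.val_injective] at this
    have hF : ∀ v, v ∈ F.ker ↔ ∀ x, v x • a (x : D) = 0 := fun v => by
      refine ⟨fun hv x => ?_, fun hv => Finset.sum_eq_zero fun x _ => ?_⟩
      · have := DFunLike.congr_fun (LinearMap.mem_ker.1 hv) (x : D)
        simp only [F, Finsupp.linearCombination_apply, Finsupp.sum_apply, Finsupp.smul_single,
          Finsupp.single_apply, Subtype.coe_inj] at this
        rw [Finsupp.sum_eq_single x] at this
        · simpa using this
        · intro y _ hy
          simp [hy]
        · simp
      · simp only [LinearMap.coe_smulRight, LinearMap.id_apply, Finsupp.smul_single, hv x,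
          Finsupp.single_zero]
    ext v
    rw [hT, hF]
    exact forall_congr' fun x => (ha x _).symm
  -- Divisible groups are injective, so the map on the span of `s` induced by `F` extends to `D`. It
  -- is injective on that span, which is essential, hence injective.
  obtain ⟨f, hf⟩ := (Module.Baer.of_divisible (D →₀ ratSqrtTwoToCircle.range)).extension_property
    (T.ker.liftQ T le_rfl) (LinearMap.ker_eq_bot.1 (Submodule.ker_liftQ_eq_bot _ _ _ le_rfl))
    (T.ker.liftQ F hFT.le)
  have hfT : ∀ v, f (T v) = F v := fun v => by
    simpa using LinearMap.congr_fun hf (Submodule.Quotient.mk v)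
  refine ⟨f.toAddMonoidHom, (injective_iff_map_eq_zero _).2 fun d hd => ?_⟩
  by_contra hd0
  obtain ⟨n, hn0, hn⟩ := exists_zsmul_mem_span_of_maximal_cyclicIndependent hs hd0
  have : n • d ∈ T.range := by
    rw [Finsupp.range_linearCombination]; simpa using hn
  obtain ⟨v, hv⟩ := this
  refine hn0 (hv ▸ ?_)
  change v ∈ T.ker
  rw [hFT, LinearMap.mem_ker, ← hfT, hv, map_zsmul]
  simpa using congrArg (n • ·) hd

/-- Every abelian group embeds into a compact group in such a way that its image is a countable
union of discrete sets. -/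
theorem exists_hom_circle_pi_sigma_discrete (D : Type u) [AddCommGroup D] :
    ∃ (ψ : D →+ (D → UnitAddCircle)) (ι : Type) (_ : Countable ι) (S : ι → Set D),
      Function.Injective ψ ∧ (⋃ i, S i) = Set.univ ∧ ∀ i, ∀ d ∈ S i, ∃ V : Set (D → UnitAddCircle),
        IsOpen V ∧ ψ d ∈ V ∧ ∀ e ∈ S i, ψ e ∈ V → e = d := by
  classical
  obtain ⟨f, hf⟩ := exists_injective_finsupp_ratSqrtTwoToCircle D
  have : Countable ratSqrtTwoToCircle.range :=
    ratSqrtTwoToCircle.rangeRestrict_surjective.countable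
  let c : (D →₀ ratSqrtTwoToCircle.range) →+ (D → UnitAddCircle) :=
    { toFun := fun g x => g x
      map_zero' := rfl
      map_add' := fun _ _ => rfl }
  refine ⟨c.comp f, ℕ × Finset ratSqrtTwoToCircle.range, inferInstance,
    fun i => {d | (f d).support.card = i.1 ∧ ∀ x, f d x ∈ i.2}, ?_, ?_, ?_⟩
  · exact fun d e h => hf (Finsupp.ext fun x => Subtype.ext (congrFun h x))
  · refine Set.eq_univ_of_forall fun d => Set.mem_iUnion.2
      ⟨((f d).support.card, insert 0 ((f d).support.image (f d))), rfl, fun x => ?_⟩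
    by_cases hx : f d x = 0
    · simp [hx]
    · exact Finset.mem_insert_of_mem (Finset.mem_image_of_mem _ (Finsupp.mem_support_iff.2 hx))
  · rintro ⟨n, F⟩ d ⟨hdn, hdF⟩
    -- Excluding the other values in `F` forces agreement with `f d` on its support; equal
    -- cardinalities then force equal supports.
    refine ⟨⋂ x ∈ (f d).support, ⋂ a ∈ F.erase (f d x), {b | b x ≠ a}, ?_, ?_, ?_⟩
    · exact isOpen_biInter_finset fun x _ => isOpen_biInter_finset fun a _ =>
        isOpen_ne_fun (continuous_apply x) continuous_const
    · simp only [Set.mem_iInter, Set.mem_ofPred_eq]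
      exact fun x _ a ha h => (Finset.mem_erase.1 ha).1 (Subtype.ext h).symm
    · rintro e ⟨hen, heF⟩ he
      simp only [Set.mem_iInter, Set.mem_ofPred_eq] at he
      have key : ∀ x ∈ (f d).support, f e x = f d x := fun x hx => by
        by_contra hne
        exact he x hx (f e x) (Finset.mem_erase.2 ⟨hne, heF x⟩) rfl
      have hsub : (f d).support ⊆ (f e).support := fun x hx => by
        rw [Finsupp.mem_support_iff, key x hx]
        exact Finsupp.mem_support_iff.1 hx
      have hsupp : (f d).support = (f e).support :=
        Finset.eq_of_subset_of_card_le hsub (by rw [hen, hdn])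
      refine hf (Finsupp.ext fun x => ?_)
      by_cases hx : x ∈ (f d).support
      · exact key x hx
      · rw [Finsupp.notMem_support_iff.1 hx, Finsupp.notMem_support_iff.1 (hsupp ▸ hx)]

/-! ### Borel sets, cocompact subgroups and Haar null sets -/

/-- A discrete subset of a `T₁` space is open in its closure, hence Borel. -/
theorem measurableSet_of_isOpen_inter_eq_singleton {X : Type*} [TopologicalSpace X] [T1Space X]
    [MeasurableSpace X] [BorelSpace X] {s : Set X}
    (hs : ∀ x ∈ s, ∃ V : Set X, IsOpen V ∧ x ∈ V ∧ ∀ y ∈ s, y ∈ V → y = x) :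
    MeasurableSet s := by
  choose! V hV hxV hVs using hs
  have : s = closure s ∩ ⋃ x ∈ s, V x := by
    refine Set.Subset.antisymm (fun x hx => ⟨subset_closure hx, Set.mem_biUnion hx (hxV x hx)⟩) ?_
    rintro y ⟨hy, hyV⟩
    obtain ⟨x, hx, hyx⟩ := Set.mem_iUnion₂.1 hyV
    have h : y ∈ closure (V x ∩ s) := (hV x hx).inter_closure ⟨hyx, hy⟩
    have hsub : V x ∩ s ⊆ {x} := fun z hz => hVs x hx z hz.2 hz.1
    have := closure_minimal hsub isClosed_singleton h
    exact this ▸ hx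
  rw [this]
  exact isClosed_closure.measurableSet.inter (isOpen_biUnion fun x hx => hV x hx).measurableSet

/-- A cocompact subgroup of a locally compact group has a compact set of coset representatives. -/
theorem exists_isCompact_image_mk_eq_univ {X : Type*} [AddCommGroup X] [TopologicalSpace X]
    [IsTopologicalAddGroup X] [LocallyCompactSpace X] (L : AddSubgroup X) [CompactSpace (X ⧸ L)] :
    ∃ C : Set X, IsCompact C ∧ ((↑) : X → X ⧸ L) '' C = Set.univ := by
  choose K hK hxK using fun x : X => exists_compact_mem_nhds x
  obtain ⟨t, ht⟩ := isCompact_univ.elim_finite_subcover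
    (fun x : X => ((↑) : X → X ⧸ L) '' interior (K x))
    (fun x => QuotientAddGroup.isOpenMap_coe _ isOpen_interior) (fun q _ => by
      obtain ⟨x, rfl⟩ := QuotientAddGroup.mk_surjective q
      exact Set.mem_iUnion.2 ⟨x, Set.mem_image_of_mem _ (mem_interior_iff_mem_nhds.2 (hxK x))⟩)
  refine ⟨⋃ x ∈ t, K x, t.isCompact_biUnion fun x _ => hK x, Set.eq_univ_of_univ_subset ?_⟩
  refine ht.trans (Set.iUnion₂_subset fun x hx => Set.image_mono ?_)
  exact interior_subset.trans (Set.subset_biUnion_of_mem (u := K) hx)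

/-- A homomorphism onto `H` with compact fibres over compact sets pulls compact Haar null sets back
to Haar null sets. -/
theorem addHaar_preimage_eq_zero {H H' : Type*}
    [AddCommGroup H] [TopologicalSpace H] [IsTopologicalAddGroup H] [LocallyCompactSpace H]
    [MeasurableSpace H] [BorelSpace H] [T2Space H]
    [AddCommGroup H'] [TopologicalSpace H'] [IsTopologicalAddGroup H'] [LocallyCompactSpace H']
    [MeasurableSpace H'] [BorelSpace H'] (p : H' →+ H) (hp : Continuous p)
    (hsurj : Function.Surjective p) (hproper : ∀ K, IsCompact K → IsCompact (p ⁻¹' K))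
    {A : Set H} (hA : IsCompact A) (h0 : MeasureTheory.Measure.addHaar A = 0) :
    MeasureTheory.Measure.addHaar (p ⁻¹' A) = 0 := by
  let ν := (MeasureTheory.Measure.addHaar : MeasureTheory.Measure H').map p
  have hν : ν.IsAddLeftInvariant :=
    MeasureTheory.isAddLeftInvariant_map (p : AddHom H' H) hp.measurable hsurj
  have hfin : MeasureTheory.IsFiniteMeasureOnCompacts ν := ⟨fun K hK => by
    rw [MeasureTheory.Measure.map_apply hp.measurable hK.isClosed.measurableSet]
    exact (hproper K hK).measure_lt_top⟩
  -- On sets with compact closure, uniqueness of Haar measure needs no regularity of the pushforward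
  -- `ν`.
  have := MeasureTheory.Measure.measure_isAddInvariant_eq_smul_of_isCompact_closure ν
    MeasureTheory.Measure.addHaar hA.closure
  rwa [h0, smul_zero, MeasureTheory.Measure.map_apply hp.measurable hA.isClosed.measurableSet]
    at this

/-! ### Extending a cut-and-project scheme by a compact group -/

section Extension

variable {G : Type u} {H : Type v} {B : Type*} [AddCommGroup G] [AddCommGroup H] [TopologicalSpace H] [IsTopologicalAddGroup H]
  [AddCommGroup B] [TopologicalSpace B] [IsTopologicalAddGroup B]

/-- The internal space of the extension of a cut-and-project scheme `(G, H, L)` along a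
homomorphism `ψ : G → B`: the closure of `{(h, ψ g) : (g, h) ∈ L}` in `H × B`. -/
def extendedInternalSpace (L : AddSubgroup (G × H)) (ψ : G →+ B) : AddSubgroup (H × B) :=
  (L.map ((AddMonoidHom.snd G H).prod (ψ.comp (AddMonoidHom.fst G H)))).topologicalClosure

/-- The lattice of the extension of `(G, H, L)` along `ψ`, consisting of all `(g, (h, ψ g))` with
`(g, h) ∈ L`. -/
def extendedLattice (L : AddSubgroup (G × H)) (ψ : G →+ B) :
    AddSubgroup (G × extendedInternalSpace L ψ) where
  carrier := {x | (x.1, x.2.1.1) ∈ L ∧ x.2.1.2 = ψ x.1}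
  zero_mem' := ⟨L.zero_mem, (map_zero ψ).symm⟩
  add_mem' := fun {x y} hx hy => ⟨L.add_mem hx.1 hy.1, by
    change x.2.1.2 + y.2.1.2 = ψ (x.1 + y.1)
    rw [hx.2, hy.2, map_add]⟩
  neg_mem' := fun {x} hx => ⟨L.neg_mem hx.1, by
    change -x.2.1.2 = ψ (-x.1)
    rw [hx.2, map_neg]⟩

theorem mem_extendedLattice {L : AddSubgroup (G × H)} {ψ : G →+ B}
    {x : G × extendedInternalSpace L ψ} :
    x ∈ extendedLattice L ψ ↔ (x.1, x.2.1.1) ∈ L ∧ x.2.1.2 = ψ x.1 := Iff.rfl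

/-- The projection of the extended internal space to the original one. -/
def extendedInternalSpaceFst (L : AddSubgroup (G × H)) (ψ : G →+ B) :
    extendedInternalSpace L ψ →+ H :=
  (AddMonoidHom.fst H B).comp (extendedInternalSpace L ψ).subtype

theorem mk_mem_extendedInternalSpace {L : AddSubgroup (G × H)} (ψ : G →+ B) {g : G} {h : H}
    (hgh : (g, h) ∈ L) : (h, ψ g) ∈ extendedInternalSpace L ψ :=
  subset_closure ⟨(g, h), hgh, rfl⟩

theorem isClosed_extendedInternalSpace (L : AddSubgroup (G × H)) (ψ : G →+ B) :
    IsClosed (extendedInternalSpace L ψ : Set (H × B)) :=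
  AddSubgroup.isClosed_topologicalClosure _

theorem continuous_extendedInternalSpaceFst (L : AddSubgroup (G × H)) (ψ : G →+ B) :
    Continuous (extendedInternalSpaceFst L ψ) :=
  continuous_fst.comp continuous_subtype_val

theorem isCompact_preimage_extendedInternalSpaceFst [CompactSpace B] (L : AddSubgroup (G × H))
    (ψ : G →+ B) {K : Set H} (hK : IsCompact K) :
    IsCompact (extendedInternalSpaceFst L ψ ⁻¹' K) := by
  have := (isClosed_extendedInternalSpace L ψ).isClosedEmbedding_subtypeVal.isCompact_preimage
    (hK.prod (isCompact_univ (X := B)))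
  rwa [Set.prod_univ] at this

variable [TopologicalSpace G]

/-- Projecting along the compact factor `B` is a closed map, so the image is closed; it contains the
dense projection of `L`. -/
theorem surjective_extendedInternalSpaceFst [CompactSpace B] {L : AddSubgroup (G × H)}
    (hL : IsCutAndProjectScheme L) (ψ : G →+ B) :
    Function.Surjective (extendedInternalSpaceFst L ψ) := by
  have hclosed : IsClosed (Prod.fst '' (extendedInternalSpace L ψ : Set (H × B))) :=
    isClosedMap_fst_of_compactSpace _ (isClosed_extendedInternalSpace L ψ)
  have hsub : Prod.snd '' (L : Set (G × H)) ⊆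
      Prod.fst '' (extendedInternalSpace L ψ : Set (H × B)) := by
    rintro _ ⟨⟨g, h⟩, hgh, rfl⟩
    exact ⟨(h, ψ g), mk_mem_extendedInternalSpace ψ hgh, rfl⟩
  intro h
  obtain ⟨x, hx, rfl⟩ := (hL.dense_snd.mono hsub).closure_eq.symm.subset (Set.mem_univ h) |>
    hclosed.closure_subset
  exact ⟨⟨x, hx⟩, rfl⟩

theorem IsCutAndProjectScheme.extendedLattice [IsTopologicalAddGroup G]
    [LocallyCompactSpace G] [LocallyCompactSpace H]
    [CompactSpace B] {L : AddSubgroup (G × H)} (hL : IsCutAndProjectScheme L) (ψ : G →+ B) :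
    IsCutAndProjectScheme (extendedLattice L ψ) where
  discrete := by
    have := hL.discrete
    let q : _root_.extendedLattice L ψ → L := fun x => ⟨(x.1.1, x.1.2.1.1), x.2.1⟩
    have hq : Continuous q := by
      refine Continuous.subtype_mk ?_ _
      fun_prop
    refine DiscreteTopology.of_continuous_injective hq fun x y hxy => ?_
    have h : (x.1.1, x.1.2.1.1) = (y.1.1, y.1.2.1.1) := congrArg Subtype.val hxy
    obtain ⟨h1, h2⟩ := Prod.mk.inj h
    refine Subtype.ext (Prod.ext h1 (Subtype.ext (Prod.ext h2 ?_)))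
    rw [x.2.2, y.2.2, h1]
  cocompact := by
    have := hL.cocompact
    obtain ⟨C, hC, hCL⟩ := exists_isCompact_image_mk_eq_univ L
    have hemb : Topology.IsClosedEmbedding
        (Prod.map id Subtype.val : G × extendedInternalSpace L ψ → G × (H × B)) :=
      Topology.IsClosedEmbedding.id.prodMap
        (isClosed_extendedInternalSpace L ψ).isClosedEmbedding_subtypeVal
    have hC' : IsCompact ((Homeomorph.prodAssoc G H B).symm ⁻¹' (C ×ˢ Set.univ)) :=
      (Homeomorph.prodAssoc G H B).symm.isCompact_preimage.2 (hC.prod isCompact_univ)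
    have hK := (hemb.isCompact_preimage hC').image
      (QuotientAddGroup.continuous_mk (N := _root_.extendedLattice L ψ))
    refine ⟨(Set.eq_univ_of_forall fun z => ?_) ▸ hK⟩
    obtain ⟨⟨g, ⟨⟨h, b⟩, hhb⟩⟩, rfl⟩ := QuotientAddGroup.mk_surjective z
    obtain ⟨⟨c, k⟩, hck, hmk⟩ := hCL.symm.subset (Set.mem_univ ((g, h) : (G × H) ⧸ L))
    have hl : (g - c, h - k) ∈ L := by
      simpa [sub_eq_add_neg, add_comm] using QuotientAddGroup.eq.1 hmk
    -- Translating by the lift of the lattice vector `(g - c, h - k)` moves the point over `C`; its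
    -- `B`-coordinate is unconstrained, as `B` is compact.
    refine ⟨(c, ⟨(h, b) - (h - k, ψ (g - c)),
      sub_mem hhb (mk_mem_extendedInternalSpace ψ hl)⟩), ⟨?_, trivial⟩, ?_⟩
    · simpa [Homeomorph.prodAssoc] using hck
    · refine QuotientAddGroup.eq.2 (mem_extendedLattice.2 ⟨?_, ?_⟩)
      · simpa [sub_eq_add_neg, add_comm] using hl
      · simp [sub_eq_add_neg, add_comm]
  injOn_fst := by
    intro x hx y hy hxy
    have h := hL.injOn_fst (mem_extendedLattice.1 hx).1 (mem_extendedLattice.1 hy).1 hxy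
    refine Prod.ext hxy (Subtype.ext (Prod.ext (congrArg Prod.snd h) ?_))
    rw [(mem_extendedLattice.1 hx).2, (mem_extendedLattice.1 hy).2, hxy]
  dense_snd := by
    rw [Subtype.dense_iff]
    refine fun x hx => closure_mono ?_ hx
    rintro _ ⟨⟨g, h⟩, hgh, rfl⟩
    exact ⟨⟨(h, ψ g), mk_mem_extendedInternalSpace ψ hgh⟩,
      ⟨(g, ⟨(h, ψ g), mk_mem_extendedInternalSpace ψ hgh⟩), ⟨hgh, rfl⟩, rfl⟩, rfl⟩

end Extension

/-! ### Comparing the three kinds of model sets -/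

theorem projectionSet_mono {G : Type u} {H : Type v} [AddCommGroup G] [AddCommGroup H]
    (L : AddSubgroup (G × H)) {V W : Set H} (h : V ⊆ W) : projectionSet L V ⊆ projectionSet L W :=
  Set.image_mono (Set.inter_subset_inter_right _ (Set.prod_mono_right h))

section ModelSets

variable {G : Type u} [AddCommGroup G] [TopologicalSpace G]

theorem IsRegularModelSet.isInterRegularModelSet {Γ : Set G} (h : IsRegularModelSet Γ) :
    IsInterRegularModelSet Γ := by
  obtain ⟨H, _, _, _, _, _, _, _, L, W, hL, hW, rfl⟩ := h
  exact ⟨H, _, _, ‹_›, ‹_›, ‹_›, _, ‹_›, L, W, hL, hW, projectionSet_mono L interior_subset,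
    projectionSet_mono L subset_closure⟩

theorem IsInterRegularModelSet.isAlmostRegularModelSet {Γ : Set G}
    (h : IsInterRegularModelSet Γ) : IsAlmostRegularModelSet Γ := by
  obtain ⟨H, _, _, _, _, _, _, _, L, W, hL, ⟨⟨hW, hne⟩, h0⟩, h1, h2⟩ := h
  exact ⟨H, _, _, ‹_›, ‹_›, ‹_›, _, ‹_›, L, interior W, closure W, hL,
    interior_subset.trans subset_closure, hne, isOpen_interior, hW.1, h0, h1, h2⟩

/-- A window enclosed between `U` and `W` may fail to be Borel in the given internal space if `G`
is not `σ`-compact. This is repaired by extending the internal space by a compact group in which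
`G` becomes a countable union of discrete sets. -/
theorem IsAlmostRegularModelSet.isRegularModelSet [IsTopologicalAddGroup G]
    [LocallyCompactSpace G] {Γ : Set G} (hΓ : IsAlmostRegularModelSet Γ) :
    IsRegularModelSet Γ := by
  obtain ⟨H, _, _, _, _, _, _, _, L, U, W, hL, hUW, hUne, hU, hW, h0, hUΓ, hΓW⟩ := hΓ
  obtain ⟨ψ, ι, _, S, hψ, hS, hdisc⟩ := exists_hom_circle_pi_sigma_discrete G
  let H' := extendedInternalSpace L ψ
  let p : H' →+ H := extendedInternalSpaceFst L ψ
  have hp : Continuous p := continuous_extendedInternalSpaceFst L ψ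
  have hpW : IsCompact (p ⁻¹' W) := isCompact_preimage_extendedInternalSpaceFst L ψ hW
  have hsurj : Function.Surjective p := surjective_extendedInternalSpaceFst hL ψ
  have : LocallyCompactSpace H' :=
    (isClosed_extendedInternalSpace L ψ).isClosedEmbedding_subtypeVal.locallyCompactSpace
  let _ : MeasurableSpace H' := borel H'
  have : BorelSpace H' := ⟨rfl⟩
  -- The new star image of `Γ`, cut into discrete pieces.
  let star (i : ι) : Set H' := {x | ∃ g ∈ Γ ∩ S i, (g, x.1.1) ∈ L ∧ x.1.2 = ψ g}
  let V : Set H' := p ⁻¹' U ∪ ⋃ i, star i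
  have hstar : ∀ i, MeasurableSet (star i) := fun i => by
    refine measurableSet_of_isOpen_inter_eq_singleton ?_
    rintro x ⟨g, ⟨-, hgS⟩, hgL, hgψ⟩
    obtain ⟨O, hO, hgO, hOS⟩ := hdisc i g hgS
    refine ⟨(fun y : H' => y.1.2) ⁻¹' O, hO.preimage (by fun_prop), ?_, ?_⟩
    · rw [Set.mem_preimage, hgψ]
      exact hgO
    · rintro y ⟨g', ⟨-, hgS'⟩, hgL', hgψ'⟩ hy
      rw [Set.mem_preimage, hgψ'] at hy
      obtain rfl := hOS g' hgS' hy
      refine Subtype.ext (Prod.ext ?_ (hgψ'.trans hgψ.symm))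
      exact congrArg Prod.snd (hL.injOn_fst hgL' hgL rfl)
  have hVW : V ⊆ p ⁻¹' W := by
    refine Set.union_subset (Set.preimage_mono hUW) (Set.iUnion_subset fun i => ?_)
    rintro x ⟨g, ⟨hgΓ, -⟩, hgL, -⟩
    obtain ⟨⟨g', h⟩, ⟨hL', -, hh⟩, rfl⟩ := hΓW hgΓ
    obtain rfl : h = x.1.1 := congrArg Prod.snd (hL.injOn_fst hL' hgL rfl)
    exact hh
  have hUV : p ⁻¹' U ⊆ interior V :=
    interior_maximal Set.subset_union_left (hU.preimage hp)
  have hcl : closure V ⊆ p ⁻¹' W := closure_minimal hVW hpW.isClosed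
  refine ⟨H', inferInstance, inferInstance, inferInstance, inferInstance, inferInstance,
    inferInstance, inferInstance, extendedLattice L ψ, V, hL.extendedLattice ψ,
    ⟨⟨⟨hpW.of_isClosed_subset isClosed_closure hcl, ?_⟩, ?_⟩, ?_⟩, ?_⟩
  · exact (hU.preimage hp).measurableSet.union (MeasurableSet.iUnion hstar)
  · exact (hUne.preimage hsurj).mono hUV
  · refine MeasureTheory.measure_mono_null ?_ (addHaar_preimage_eq_zero p hp hsurj
      (fun K hK => isCompact_preimage_extendedInternalSpaceFst L ψ hK) (hW.diff hU) h0)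
    exact fun x hx => ⟨hcl hx.1, fun hxU => hx.2 (hUV hxU)⟩
  · refine Set.Subset.antisymm (fun g hg => ?_) ?_
    · obtain ⟨⟨g, h⟩, ⟨hgL, -⟩, rfl⟩ := hΓW hg
      obtain ⟨i, hi⟩ := Set.mem_iUnion.1 (hS.symm.subset (Set.mem_univ g))
      exact ⟨(g, ⟨(h, ψ g), mk_mem_extendedInternalSpace ψ hgL⟩), ⟨⟨hgL, rfl⟩, trivial,
        Or.inr (Set.mem_iUnion.2 ⟨i, g, ⟨hg, hi⟩, hgL, rfl⟩)⟩, rfl⟩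
    · rintro _ ⟨⟨g, x⟩, ⟨⟨hgL, hgψ⟩, -, hx⟩, rfl⟩
      -- Over `U` every lattice point belongs to `Γ` anyway; in a star piece, injectivity of `ψ`
      -- identifies `g` with a point of `Γ`.
      rcases hx with hx | hx
      · exact hUΓ ⟨(g, x.1.1), ⟨hgL, trivial, hx⟩, rfl⟩
      · obtain ⟨i, g', ⟨hgΓ, -⟩, -, hgψ'⟩ := Set.mem_iUnion.1 hx
        exact hψ (hgψ'.symm.trans hgψ) ▸ hgΓ

end ModelSets

/-- The implications hold for arbitrary subsets of `G`: point sets, finite local complexity and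
repetitivity are not needed once the internal space may be extended. -/
theorem mainTheorem6 {G : Type u} [AddCommGroup G] [TopologicalSpace G] [IsTopologicalAddGroup G]
    [LocallyCompactSpace G] [T2Space G] (Γ : Set G) (hpt : IsPointSet Γ)
    (hflc : HasFiniteLocalComplexity Γ) (hrep : IsRepetitive Γ) :
    List.TFAE [IsRegularModelSet Γ, IsInterRegularModelSet Γ, IsAlmostRegularModelSet Γ] := by
  tfae_have 1 → 2 := IsRegularModelSet.isInterRegularModelSet
  tfae_have 2 → 3 := IsInterRegularModelSet.isAlmostRegularModelSet
  tfae_have 3 → 1 := IsAlmostRegularModelSet.isRegularModelSet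
  tfae_finish
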